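/- Let $[n]=\{1,\dots,n\}$ with $n\ge 1$. A distribution over $[n]$ is a vector $p=(p(1),\dots,p(n))$ of non-negative reals with sum $1$, and $d_{\mathrm{TV}}(p,q)=\frac12\sum_{i=1}^n|p(i)-q(i)|$. A $k$-mixture of distributions in a class $\mathfrak C$ is a distribution $\sum_{j=1}^k\mu_jp_j$ with $p_j\in\mathfrak C$, $\mu_j\ge 0$ and $\sum_j\mu_j=1$. A (possibly randomized) algorithm $A$ over $[n]$ takes parameters $\varepsilon,\delta$, draws a number of independent samples depending only on $\varepsilon,\delta$ from an unknown target distribution $p$ over $[n]$, and outputs a hypothesis distribution $h$ over $[n]$; no computational restriction is imposed. For a fixed $\delta_0\in(0,1)$, say that $A$ learns a class $\mathfrak D$ of distributions over $[n]$ using $b(\varepsilon,\delta)$ samples if for all $\varepsilon\in(0,1)$ and $\delta\in(0,\delta_0]$ it draws at most $b(\varepsilon,\delta)$ samples and, for every target $p\in\mathfrak D$, with probability at least $1-\delta$ (over the samples and the internal randomness) the output satisfies $d_{\mathrm{TV}}(p,h)\le\varepsilon$. **Proposition (sample complexity of learning mixtures).** For every $\delta_0\in(0,1)$ (for instance $\delta_0=1/2$)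 there are constants $K>0$ and $c\in\mathbb N$, depending only on $\delta_0$, such that the following holds for all integers $n,k\ge1$, every class $\mathfrak C$ of distributions over $[n]$ and every function $m$. If there is an algorithm that learns $\mathfrak C$ using $m(n,\varepsilon)\cdot\log(1/\delta)$ samples, then there is an algorithm that learns the class of all $k$-mixtures of distributions in $\mathfrak C$ using $$K\cdot\frac{k}{\varepsilon^3}\cdot\log^c\!\Big(2+\frac k\varepsilon\Big)\cdot m(n,\varepsilon/20)\cdot\log^2(1/\delta)\;=\;\tilde O(k/\varepsilon^3)\cdot m(n,\varepsilon/20)\cdot\log^2(1/\delta)$$ samples. -/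

import Mathlib

open MeasureTheory

noncomputable section

namespace MixtureLearning

/-- Probability distributions over the domain `[n]` (indexed by `Fin n`): vectors `p` with
`p i ≥ 0` for all `i` and `∑ i, p i = 1`. The measurable structure is the Borel one inherited
from `ℝⁿ`. -/
abbrev Dist (n : ℕ) : Type := stdSimplex ℝ (Fin n)

/-- Total variation distance, `(1/2) ‖p - q‖₁`. -/
def dTV {n : ℕ} (p q : Dist n) : ℝ := (1 / 2) * ∑ i, |p.1 i - q.1 i|

/-- The `k`-mixtures `∑ j, μ j • q j` with components `q j` in the class `𝒞` and mixing weights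
`μ j ≥ 0`, `∑ j, μ j = 1`. -/
def mixtures {n : ℕ} (k : ℕ) (𝒞 : Set (Dist n)) : Set (Dist n) :=
  {p | ∃ μ ∈ stdSimplex ℝ (Fin k), ∃ q : Fin k → Dist n,
    (∀ j, q j ∈ 𝒞) ∧ ∀ i, p.1 i = ∑ j, μ j * (q j).1 i}

/-- A (possibly randomized) procedure that draws a fixed number of samples from `[n]` and outputs
a hypothesis distribution over `[n]`. `output s` is the law of the hypothesis (over the internal
randomness) when the sample is `s`; a deterministic procedure has Dirac laws. -/
structure Procedure (n : ℕ) where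
  samples : ℕ
  output : (Fin samples → Fin n) → ProbabilityMeasure (Dist n)

/-- The probability, over `samples` independent draws from `p` and the internal randomness, that
the hypothesis is within total variation distance `ε` of `p`. -/
def Procedure.successProb {n : ℕ} (P : Procedure n) (p : Dist n) (ε : ℝ) : ℝ :=
  ∑ s : Fin P.samples → Fin n,
    (∏ i, p.1 (s i)) * (P.output s : Measure (Dist n)).real {h | dTV p h ≤ ε}

/-- A learning algorithm over `[n]`: it receives an accuracy parameter `ε` and a confidence
parameter `δ`. -/
abbrev Algorithm (n : ℕ) : Type := (ε δ : ℝ) → Procedure n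

/-- `A` learns the class `𝒞` with at most `b ε δ` samples: for all accuracies `0 < ε < 1` and all
confidence parameters `0 < δ ≤ δ₀`, it draws at most `b ε δ` samples and, for every unknown target
`p ∈ 𝒞`, outputs with probability at least `1 - δ` a hypothesis at distance at most `ε`. -/
def Algorithm.Learns {n : ℕ} (A : Algorithm n) (𝒞 : Set (Dist n)) (δ₀ : ℝ)
    (b : ℝ → ℝ → ℝ) : Prop :=
  ∀ ε δ : ℝ, 0 < ε → ε < 1 → 0 < δ → δ ≤ δ₀ →
    ((A ε δ).samples : ℝ) ≤ b ε δ ∧ ∀ p ∈ 𝒞, 1 - δ ≤ (A ε δ).successProb p ε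

end MixtureLearning

end

/-!
A sample from the mixture `∑ j, μ j • q j` is obtained by drawing labels with law `μ` and then
sampling from the labelled components. Among `M ≈ (k / ε) * s` samples, where `s` is the sample
size of the given learner, every component of weight at least of order `ε / k` owns `s` samples with
high probability (`mass_card_label_lt_le`). The labels are not observed, but there are only `k ^ M`
labellings: running the learner on the equally labelled samples for each labelling, with every
choice of mixing weights that are multiples of `1 / T`, `T ≈ k / ε`, gives at most
`k ^ M * (T + 1) ^ k` candidates, one of which is close to the target (`mass_no_candidate_le`). Minimum-distance selection
over the Scheffé sets of the candidates finds one of comparable quality from about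
`log (k ^ M * (T + 1) ^ k) / ε ^ 2` further samples (`exists_selection`), which accounts for the
factor `k / ε ^ 3`.

Two reductions precede this. The learner may be taken deterministic, at the cost of doubling its
error and its failure probability (`Procedure.exists_deterministic`). And if the learner draws no
sample at some fixed confidence below `1 / 2`, the class lies in a small ball, so that no sample is
needed for mixtures either; otherwise `m n (ε / 20)` is bounded below by a constant depending only
on `δ₀`, and additive terms in the sample size can be absorbed into it (`sample_size_le`).

Probabilities are finite sums: `mass w E` is the weight of an event and `prodWeight w` the law of
independent draws.
-/

namespace MixtureLearning

/-! ### Events under finite product weights -/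

section FiniteProbability

variable {α ι κ : Type*} [Fintype α] [Fintype ι] [Fintype κ]

/-- The mass that a weight function `w` on a finite type gives to the event `E`. -/
noncomputable def mass (w : α → ℝ) (E : Set α) : ℝ := ∑ a, E.indicator w a

/-- The weight function of a family of independent draws, the `i`-th one with weights `w i`. -/
def prodWeight (w : ι → α → ℝ) (x : ι → α) : ℝ := ∏ i, w i (x i)

lemma mass_mono {w : α → ℝ} (hw : ∀ a, 0 ≤ w a) {E F : Set α} (h : E ⊆ F) :
    mass w E ≤ mass w F :=
  Finset.sum_le_sum fun a _ => Set.indicator_le_indicator_of_subset h hw a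

lemma mass_univ {w : α → ℝ} (hw : w ∈ stdSimplex ℝ α) : mass w Set.univ = 1 := by
  simp [mass, hw.2]

lemma mass_le_one {w : α → ℝ} (hw : w ∈ stdSimplex ℝ α) (E : Set α) : mass w E ≤ 1 :=
  (mass_mono hw.1 (Set.subset_univ E)).trans_eq (mass_univ hw)

lemma mass_compl {w : α → ℝ} (hw : w ∈ stdSimplex ℝ α) (E : Set α) :
    mass w Eᶜ = 1 - mass w E := by
  rw [eq_sub_iff_add_eq, ← hw.2, mass, mass, ← Finset.sum_add_distrib]
  exact Finset.sum_congr rfl fun a _ => Set.indicator_compl_add_self_apply E w a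

lemma mass_le_sum_mul {w : α → ℝ} (hw : ∀ a, 0 ≤ w a) {E : Set α} {F : α → ℝ}
    (hF : ∀ a, 0 ≤ F a) (hE : ∀ a ∈ E, 1 ≤ F a) : mass w E ≤ ∑ a, w a * F a := by
  refine Finset.sum_le_sum fun a _ => ?_
  by_cases ha : a ∈ E
  · rw [Set.indicator_of_mem ha]
    exact le_mul_of_one_le_right (hw a) (hE a ha)
  · rw [Set.indicator_of_notMem ha]
    exact mul_nonneg (hw a) (hF a)

lemma mass_iUnion_le {w : α → ℝ} (hw : ∀ a, 0 ≤ w a) (E : ι → Set α) :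
    mass w (⋃ i, E i) ≤ ∑ i, mass w (E i) := by
  unfold mass
  rw [Finset.sum_comm]
  refine Finset.sum_le_sum fun a _ => ?_
  have h0 : ∀ i ∈ Finset.univ, 0 ≤ (E i).indicator w a :=
    fun i _ => Set.indicator_nonneg (fun a _ => hw a) a
  by_cases ha : a ∈ ⋃ i, E i
  · obtain ⟨i, hi⟩ := Set.mem_iUnion.1 ha
    rw [Set.indicator_of_mem ha]
    exact (Set.indicator_of_mem hi w).ge.trans (Finset.single_le_sum h0 (Finset.mem_univ i))
  · rw [Set.indicator_of_notMem ha]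
    exact Finset.sum_nonneg h0

lemma mass_union_le {w : α → ℝ} (hw : ∀ a, 0 ≤ w a) (E F : Set α) :
    mass w (E ∪ F) ≤ mass w E + mass w F := by
  rw [Set.union_eq_iUnion]
  refine (mass_iUnion_le hw _).trans_eq ?_
  simp

lemma sum_prodWeight_mul_prod [DecidableEq ι] (w φ : ι → α → ℝ) :
    ∑ x, prodWeight w x * ∏ i, φ i (x i) = ∏ i, ∑ a, w i a * φ i a := by
  rw [Finset.prod_univ_sum, Fintype.piFinset_univ]
  exact Finset.sum_congr rfl fun x _ => Finset.prod_mul_distrib.symm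

lemma prodWeight_mem_stdSimplex [DecidableEq ι] {w : ι → α → ℝ} (hw : ∀ i, w i ∈ stdSimplex ℝ α) :
    prodWeight w ∈ stdSimplex ℝ (ι → α) := by
  refine ⟨fun x => Finset.prod_nonneg fun i _ => (hw i).1 _, ?_⟩
  have := sum_prodWeight_mul_prod w fun _ _ => 1
  simpa [(hw _).2] using this

/-- The weight of the event that the draws selected by the embedding `e` form the tuple `y`. -/
lemma sum_prodWeight_comp_eq [DecidableEq ι] {w : ι → α → ℝ} (hw : ∀ i, ∑ a, w i a = 1) (e : κ ↪ ι)
    (y : κ → α) :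
    (∑ x : ι → α, {x | x ∘ e = y}.indicator (prodWeight w) x) = prodWeight (w ∘ e) y := by
  classical
  -- The indicator of `x ∘ e = y` is a product over `ι` of functions of `x i`.
  have h1 : ∀ x : ι → α, {x | x ∘ e = y}.indicator (prodWeight w) x =
      prodWeight w x * ∏ i, ∏ a with e a = i, if x i = y a then (1 : ℝ) else 0 := by
    intro x
    have h2 : (∏ i, ∏ a with e a = i, if x i = y a then (1 : ℝ) else 0) =
        ∏ a, if x (e a) = y a then (1 : ℝ) else 0 := by
      rw [← Finset.prod_fiberwise (s := Finset.univ) (g := e)]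
      refine Finset.prod_congr rfl fun i _ => Finset.prod_congr rfl fun a ha => ?_
      rw [(Finset.mem_filter.1 ha).2]
    rw [h2, Finset.prod_ite_zero]
    by_cases h : x ∘ e = y
    · have h' : ∀ a ∈ Finset.univ, x (e a) = y a := fun a _ => congrFun h a
      rw [Set.indicator_of_mem (by exact h), if_pos h']
      simp
    · rw [Set.indicator_of_notMem (by exact h), if_neg fun h' => h (funext fun a => h' a (by simp))]
      simp
  rw [Finset.sum_congr rfl fun x _ => h1 x,
    sum_prodWeight_mul_prod w fun i b => ∏ a with e a = i, if b = y a then (1 : ℝ) else 0]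
  unfold prodWeight
  rw [← Finset.prod_fiberwise (s := Finset.univ) (g := e)]
  refine Finset.prod_congr rfl fun i _ => ?_
  by_cases hi : ∃ a, e a = i
  · obtain ⟨a, rfl⟩ := hi
    have : (Finset.univ.filter fun b => e b = e a) = {a} := by
      ext b
      simp
    simp only [this, Finset.prod_singleton]
    simp
  · have : (Finset.univ.filter fun a => e a = i) = ∅ :=
      Finset.filter_eq_empty_iff.2 fun a _ h => hi ⟨a, h⟩
    simp [this, hw]

/-- Marginals of independent draws are independent draws. -/
lemma mass_prodWeight_comp [DecidableEq ι] [DecidableEq κ] {w : ι → α → ℝ}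
    (hw : ∀ i, ∑ a, w i a = 1) (e : κ ↪ ι) (E : Set (κ → α)) :
    mass (prodWeight w) {x | x ∘ e ∈ E} = mass (prodWeight (w ∘ e)) E := by
  classical
  have h1 : ∀ y, E.indicator (prodWeight (w ∘ e)) y =
      ∑ x : ι → α, if x ∘ e = y then E.indicator (fun _ => prodWeight w x) y else 0 := by
    intro y
    by_cases hy : y ∈ E
    · rw [Set.indicator_of_mem hy, ← sum_prodWeight_comp_eq hw e y]
      refine Finset.sum_congr rfl fun x _ => ?_
      simp [hy, Set.indicator_apply]
    · simp [hy]
  unfold mass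
  rw [Finset.sum_congr rfl fun y _ => h1 y, Finset.sum_comm]
  refine Finset.sum_congr rfl fun x _ => ?_
  rw [Finset.sum_ite_eq]
  simp [Set.indicator_apply]

/-- A Hoeffding-type bound (with a weaker constant in the exponent) for centred functions bounded
by `1`, obtained from the exponential moment at `τ / 2`. -/
lemma mass_sum_gt_le {w : α → ℝ} (hw : w ∈ stdSimplex ℝ α) {f : α → ℝ} (hf : ∀ a, |f a| ≤ 1)
    (hf0 : ∑ a, w a * f a = 0) (N : ℕ) {τ : ℝ} (hτ : 0 ≤ τ) (hτ' : τ ≤ 2) :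
    mass (prodWeight fun _ : Fin N => w) {x | N * τ < ∑ i, f (x i)} ≤
      Real.exp (-(N * τ ^ 2 / 4)) := by
  have hmem := prodWeight_mem_stdSimplex fun _ : Fin N => hw
  have hmoment : ∑ a, w a * Real.exp (τ / 2 * (f a - τ)) ≤ Real.exp (-(τ ^ 2 / 4)) := by
    -- `exp y ≤ 1 + y + y ^ 2` for `|y| ≤ 1`, and the linear term has mean zero.
    have h1 : ∀ a, w a * Real.exp (τ / 2 * (f a - τ)) ≤
        Real.exp (-(τ ^ 2 / 2)) * (w a * (1 + τ ^ 2 / 4) + τ / 2 * (w a * f a)) := by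
      intro a
      have habs : |τ / 2 * f a| ≤ 1 := by
        rw [abs_mul, abs_of_nonneg (by positivity)]
        nlinarith [hf a, abs_nonneg (f a)]
      have h2 := (abs_le.1 (Real.abs_exp_sub_one_sub_id_le habs)).2
      have h3 : f a ^ 2 ≤ 1 := (sq_le_one_iff_abs_le_one _).2 (hf a)
      have h4 : Real.exp (τ / 2 * f a) ≤ 1 + τ ^ 2 / 4 + τ / 2 * f a := by
        nlinarith [mul_le_mul_of_nonneg_left h3 (sq_nonneg τ)]
      have h5 : τ / 2 * (f a - τ) = -(τ ^ 2 / 2) + τ / 2 * f a := by ring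
      rw [h5, Real.exp_add]
      have := mul_le_mul_of_nonneg_left h4
        (mul_nonneg (hw.1 a) (Real.exp_pos (-(τ ^ 2 / 2))).le)
      linarith
    refine (Finset.sum_le_sum fun a _ => h1 a).trans ?_
    rw [← Finset.mul_sum, Finset.sum_add_distrib, ← Finset.sum_mul, ← Finset.mul_sum, hf0, hw.2]
    have h6 : 1 * (1 + τ ^ 2 / 4) + τ / 2 * 0 ≤ Real.exp (τ ^ 2 / 4) := by
      linarith [Real.add_one_le_exp (τ ^ 2 / 4)]
    refine (mul_le_mul_of_nonneg_left h6 (Real.exp_pos _).le).trans_eq ?_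
    rw [← Real.exp_add]
    ring_nf
  refine (mass_le_sum_mul hmem.1 (F := fun x => ∏ i, Real.exp (τ / 2 * (f (x i) - τ)))
    (fun x => Finset.prod_nonneg fun i _ => (Real.exp_pos _).le) fun x hx => ?_).trans ?_
  · rw [← Real.exp_sum, Real.one_le_exp_iff, ← Finset.mul_sum, Finset.sum_sub_distrib]
    simp only [Set.mem_ofPred_eq] at hx
    simp only [Finset.sum_const, Finset.card_univ, Fintype.card_fin, nsmul_eq_mul]
    exact mul_nonneg (by positivity) (by linarith)
  · rw [sum_prodWeight_mul_prod (fun _ : Fin N => w) fun _ a => Real.exp (τ / 2 * (f a - τ))]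
    rw [Finset.prod_const, Finset.card_univ, Fintype.card_fin]
    refine (pow_le_pow_left₀ (Finset.sum_nonneg fun a _ =>
      mul_nonneg (hw.1 a) (Real.exp_pos _).le) hmoment N).trans_eq ?_
    rw [← Real.exp_nat_mul]
    ring_nf

/-- The empirical frequency of the event `S` in the sample `x`. -/
noncomputable def freq {N : ℕ} (x : Fin N → α) (S : Set α) : ℝ :=
  (∑ i, S.indicator 1 (x i)) / N

lemma mass_freq_deviation_le {w : α → ℝ} (hw : w ∈ stdSimplex ℝ α) (S : Set α) (N : ℕ)
    {τ : ℝ} (hτ : 0 ≤ τ) (hτ' : τ ≤ 2) :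
    mass (prodWeight fun _ : Fin N => w) {x | τ < |freq x S - mass w S|} ≤
      2 * Real.exp (-(N * τ ^ 2 / 4)) := by
  have hmem := prodWeight_mem_stdSimplex fun _ : Fin N => hw
  rcases Nat.eq_zero_or_pos N with rfl | hN
  · refine (mass_le_one hmem _).trans ?_
    norm_num
  have hN' : (0 : ℝ) < N := by exact_mod_cast hN
  set f : α → ℝ := fun a => S.indicator 1 a - mass w S with hf
  have hS0 : 0 ≤ mass w S := Finset.sum_nonneg fun a _ => Set.indicator_nonneg (fun b _ => hw.1 b) a
  have hS1 := mass_le_one hw S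
  have hf1 : ∀ a, |f a| ≤ 1 := by
    intro a
    rw [hf, abs_le]
    by_cases ha : a ∈ S
    · simp only [Set.indicator_of_mem ha, Pi.one_apply]
      constructor <;> linarith
    · simp only [Set.indicator_of_notMem ha]
      constructor <;> linarith
  have hf0 : ∑ a, w a * f a = 0 := by
    have h1 : ∀ a, w a * f a = S.indicator w a - mass w S * w a := by
      intro a
      by_cases ha : a ∈ S <;> simp [hf, ha] <;> ring
    rw [Finset.sum_congr rfl fun a _ => h1 a, Finset.sum_sub_distrib, ← Finset.mul_sum, hw.2,
      mul_one]
    exact sub_self _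
  have hsum : ∀ x : Fin N → α, ∑ i, f (x i) = N * (freq x S - mass w S) := by
    intro x
    simp only [hf, freq, Finset.sum_sub_distrib, Finset.sum_const, Finset.card_univ,
      Fintype.card_fin, nsmul_eq_mul]
    field_simp
  have hsub : {x : Fin N → α | τ < |freq x S - mass w S|} ⊆
      {x | N * τ < ∑ i, f (x i)} ∪ {x | N * τ < ∑ i, (-f) (x i)} := by
    intro x hx
    simp only [Pi.neg_apply, Finset.sum_neg_distrib, hsum, Set.mem_union, Set.mem_ofPred_eq]
    rw [← mul_neg]
    rcases lt_abs.1 (show τ < |freq x S - mass w S| from hx) with h | h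
    · exact Or.inl (mul_lt_mul_of_pos_left h hN')
    · exact Or.inr (mul_lt_mul_of_pos_left h hN')
  refine (mass_mono hmem.1 hsub).trans ((mass_union_le hmem.1 _ _).trans ?_)
  rw [two_mul]
  refine add_le_add (mass_sum_gt_le hw hf1 hf0 N hτ hτ')
    (mass_sum_gt_le hw (fun a => ?_) ?_ N hτ hτ')
  · simpa using hf1 a
  · simpa using hf0

/-- Among `N` independent labels, fewer than `s` are equal to `j` only with small probability. -/
lemma mass_card_label_lt_le [DecidableEq α] {w : α → ℝ} (hw : w ∈ stdSimplex ℝ α) (j : α)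
    (N s : ℕ) :
    mass (prodWeight fun _ : Fin N => w) {L | Fintype.card {i // L i = j} < s} ≤
      Real.exp (s - w j * N / 2) := by
  have hmem := prodWeight_mem_stdSimplex fun _ : Fin N => hw
  have hmoment : ∑ a, w a * Real.exp (-(if a = j then 1 else 0)) ≤ Real.exp (-(w j / 2)) := by
    have h1 : ∀ a, w a * Real.exp (-(if a = j then 1 else 0)) =
        w a - if a = j then w a * (1 - Real.exp (-1)) else 0 := by
      intro a
      split_ifs
      · ring
      · rw [neg_zero, Real.exp_zero, mul_one, sub_zero]
    rw [Finset.sum_congr rfl fun a _ => h1 a, Finset.sum_sub_distrib, hw.2]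
    simp only [Finset.sum_ite_eq', Finset.mem_univ, if_true]
    have h2 : Real.exp (-1) ≤ 1 / 2 := by
      rw [Real.exp_neg, ← one_div]
      exact one_div_le_one_div_of_le (by norm_num) (by linarith [Real.add_one_le_exp 1])
    nlinarith [Real.add_one_le_exp (-(w j / 2)), hw.1 j]
  refine (mass_le_sum_mul hmem.1
    -- Chernoff bound with the exponential moment at `-1`.
    (F := fun L => Real.exp s * ∏ i, Real.exp (-(if L i = j then 1 else 0)))
    (fun L => mul_nonneg (Real.exp_pos _).le (Finset.prod_nonneg fun i _ => (Real.exp_pos _).le))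
    fun L hL => ?_).trans ?_
  · rw [← Real.exp_sum, ← Real.exp_add, Real.one_le_exp_iff]
    simp only [Set.mem_ofPred_eq, Fintype.card_subtype] at hL
    have : ((Finset.univ.filter fun i => L i = j).card : ℝ) ≤ s := by exact_mod_cast hL.le
    simp only [Finset.sum_neg_distrib, Finset.sum_boole]
    linarith
  · have h3 : ∀ L : Fin N → α, prodWeight (fun _ => w) L *
        (Real.exp s * ∏ i, Real.exp (-(if L i = j then 1 else 0))) =
        Real.exp s * (prodWeight (fun _ => w) L * ∏ i, Real.exp (-(if L i = j then 1 else 0))) :=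
      fun L => by ring
    rw [Finset.sum_congr rfl fun L _ => h3 L, ← Finset.mul_sum,
      sum_prodWeight_mul_prod (fun _ : Fin N => w) fun _ a => Real.exp (-(if a = j then 1 else 0)),
      Finset.prod_const, Finset.card_univ, Fintype.card_fin]
    refine (mul_le_mul_of_nonneg_left (pow_le_pow_left₀ (Finset.sum_nonneg fun a _ =>
      mul_nonneg (hw.1 a) (Real.exp_pos _).le) hmoment N) (Real.exp_pos _).le).trans_eq ?_
    rw [← Real.exp_nat_mul, ← Real.exp_add]
    ring_nf

/-- Two-stage sampling: if the first `M` draws avoid `B`, the failure probability is that of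
the last `N` draws alone. -/
lemma mass_append_le {w : α → ℝ} (hw : w ∈ stdSimplex ℝ α) {M N : ℕ} (B : Set (Fin M → α))
    (E : (Fin M → α) → Set (Fin N → α)) {η : ℝ} (hη : 0 ≤ η)
    (h : ∀ x ∉ B, mass (prodWeight fun _ : Fin N => w) (E x) ≤ η) :
    mass (prodWeight fun _ : Fin (M + N) => w)
      {z | (fun i => z (Fin.natAdd M i)) ∈ E fun i => z (Fin.castAdd N i)} ≤
      mass (prodWeight fun _ : Fin M => w) B + η := by
  classical
  have hM := prodWeight_mem_stdSimplex fun _ : Fin M => hw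
  have hN := prodWeight_mem_stdSimplex fun _ : Fin N => hw
  have h1 : mass (prodWeight fun _ : Fin (M + N) => w)
      {z | (fun i => z (Fin.natAdd M i)) ∈ E fun i => z (Fin.castAdd N i)} =
      ∑ x : Fin M → α, prodWeight (fun _ => w) x * mass (prodWeight fun _ : Fin N => w) (E x) := by
    unfold mass
    rw [← (Fin.appendEquiv M N).sum_comp, Fintype.sum_prod_type]
    refine Finset.sum_congr rfl fun x _ => ?_
    rw [Finset.mul_sum]
    refine Finset.sum_congr rfl fun y _ => ?_
    simp [Set.indicator_apply, prodWeight, Fin.appendEquiv, Fin.prod_univ_add]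
  rw [h1, mass]
  have h2 : η = ∑ x : Fin M → α, prodWeight (fun _ => w) x * η := by
    rw [← Finset.sum_mul, hM.2, one_mul]
  rw [h2, ← Finset.sum_add_distrib]
  refine Finset.sum_le_sum fun x _ => ?_
  by_cases hx : x ∈ B
  · rw [Set.indicator_of_mem hx]
    have := mul_le_mul_of_nonneg_left (mass_le_one hN (E x)) (hM.1 x)
    linarith [mul_nonneg (hM.1 x) hη]
  · rw [Set.indicator_of_notMem hx, zero_add]
    exact mul_le_mul_of_nonneg_left (h x hx) (hM.1 x)

end FiniteProbability

/-! ### Total variation distance -/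

section TotalVariation

variable {n : ℕ}

lemma dTV_comm (p q : Dist n) : dTV p q = dTV q p := by
  simp only [dTV, abs_sub_comm]

lemma dTV_triangle (p q r : Dist n) : dTV p r ≤ dTV p q + dTV q r := by
  unfold dTV
  rw [← mul_add, ← Finset.sum_add_distrib]
  exact mul_le_mul_of_nonneg_left (Finset.sum_le_sum fun i _ => abs_sub_le _ _ _) (by norm_num)

lemma measurableSet_dTV_le (p : Dist n) (ε : ℝ) : MeasurableSet {h : Dist n | dTV p h ≤ ε} := by
  have : Continuous fun h : Dist n => dTV p h := by
    exact continuous_const.mul (continuous_finsetSum _ fun i _ =>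
      (continuous_const.sub ((continuous_apply i).comp continuous_subtype_val)).abs)
  exact (isClosed_le this continuous_const).measurableSet

/-- The Scheffé set of `p` against `q`. -/
def scheffe (p q : Dist n) : Set (Fin n) := {i | q.1 i < p.1 i}

lemma dTV_eq_mass_scheffe (p q : Dist n) :
    dTV p q = mass p.1 (scheffe p q) - mass q.1 (scheffe p q) := by
  have h1 : ∀ i, |p.1 i - q.1 i| =
      2 * ((scheffe p q).indicator p.1 i - (scheffe p q).indicator q.1 i) - (p.1 i - q.1 i) := by
    intro i
    by_cases hi : i ∈ scheffe p q
    · rw [Set.indicator_of_mem hi, Set.indicator_of_mem hi, abs_of_pos (sub_pos.2 hi)]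
      ring
    · rw [Set.indicator_of_notMem hi, Set.indicator_of_notMem hi,
        abs_of_nonpos (sub_nonpos.2 (not_lt.1 hi))]
      ring
  rw [dTV, Finset.sum_congr rfl fun i _ => h1 i, Finset.sum_sub_distrib, ← Finset.mul_sum,
    Finset.sum_sub_distrib, Finset.sum_sub_distrib, p.2.2, q.2.2, mass, mass]
  ring

lemma mass_sub_mass_le_dTV (p q : Dist n) (S : Set (Fin n)) :
    mass p.1 S - mass q.1 S ≤ dTV p q := by
  rw [dTV_eq_mass_scheffe, mass, mass, mass, mass, ← Finset.sum_sub_distrib,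
    ← Finset.sum_sub_distrib]
  refine Finset.sum_le_sum fun i _ => ?_
  by_cases hS : i ∈ S <;> by_cases hi : i ∈ scheffe p q <;> simp only [hS, hi,
    Set.indicator_of_mem, Set.indicator_of_notMem, not_false_eq_true, sub_zero, le_refl]
  · exact sub_nonpos.2 (not_lt.1 hi)
  · exact (sub_pos.2 hi).le

lemma abs_mass_sub_mass_le_dTV (p q : Dist n) (S : Set (Fin n)) :
    |mass p.1 S - mass q.1 S| ≤ dTV p q :=
  abs_le.2 ⟨by linarith [mass_sub_mass_le_dTV q p S, dTV_comm p q], mass_sub_mass_le_dTV p q S⟩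

lemma dTV_mixture_le {k : ℕ} {μ : Fin k → ℝ} (hμ : μ ∈ stdSimplex ℝ (Fin k)) {q : Fin k → Dist n}
    {p : Dist n} (hp : ∀ i, p.1 i = ∑ j, μ j * (q j).1 i) {h : Dist n} {ρ : ℝ}
    (hq : ∀ j, dTV (q j) h ≤ ρ) : dTV p h ≤ ρ := by
  have h1 : ∀ i, |p.1 i - h.1 i| ≤ ∑ j, μ j * |(q j).1 i - h.1 i| := by
    intro i
    have : p.1 i - h.1 i = ∑ j, μ j * ((q j).1 i - h.1 i) := by
      simp only [mul_sub, Finset.sum_sub_distrib, ← Finset.sum_mul, hμ.2, one_mul, hp]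
    rw [this]
    refine (Finset.abs_sum_le_sum_abs _ _).trans_eq (Finset.sum_congr rfl fun j _ => ?_)
    rw [abs_mul, abs_of_nonneg (hμ.1 j)]
  calc dTV p h ≤ 1 / 2 * ∑ i, ∑ j, μ j * |(q j).1 i - h.1 i| :=
        mul_le_mul_of_nonneg_left (Finset.sum_le_sum fun i _ => h1 i) (by norm_num)
    _ = ∑ j, μ j * dTV (q j) h := by
        rw [Finset.sum_comm, Finset.mul_sum]
        refine Finset.sum_congr rfl fun j _ => ?_
        rw [← Finset.mul_sum, dTV]
        ring
    _ ≤ ∑ j, μ j * ρ := Finset.sum_le_sum fun j _ => mul_le_mul_of_nonneg_left (hq j) (hμ.1 j)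
    _ = ρ := by rw [← Finset.sum_mul, hμ.2, one_mul]

lemma dist_nonempty (hn : 1 ≤ n) : Nonempty (Dist n) :=
  ⟨⟨Pi.single (⟨0, hn⟩ : Fin n) 1, single_mem_stdSimplex ℝ _⟩⟩

end TotalVariation

/-! ### Deterministic learners -/

section Deterministic

variable {n : ℕ}

/-- The weight function of `N` independent samples from `p`. -/
abbrev iid (p : Dist n) (N : ℕ) : (Fin N → Fin n) → ℝ := prodWeight fun _ => p.1

lemma iid_mem_stdSimplex (p : Dist n) (N : ℕ) : iid p N ∈ stdSimplex ℝ (Fin N → Fin n) :=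
  prodWeight_mem_stdSimplex fun _ => p.2

/-- The procedure that draws `N` samples and applies the map `f` to them. -/
noncomputable def Procedure.ofFun {N : ℕ} (f : (Fin N → Fin n) → Dist n) : Procedure n where
  samples := N
  output s := ⟨Measure.dirac (f s), inferInstance⟩

lemma le_successProb_ofFun {N : ℕ} (f : (Fin N → Fin n) → Dist n) (p : Dist n) {ε δ : ℝ}
    (h : mass (iid p N) {s | ε < dTV p (f s)} ≤ δ) :
    1 - δ ≤ (Procedure.ofFun f).successProb p ε := by
  have h1 : (Procedure.ofFun f).successProb p ε = mass (iid p N) {s | ε < dTV p (f s)}ᶜ := by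
    have h2 : ∀ s : Fin N → Fin n,
        (∏ i, p.1 (s i)) * (Measure.dirac (f s)).real {h | dTV p h ≤ ε} =
          {s | ε < dTV p (f s)}ᶜ.indicator (iid p N) s := by
      intro s
      rw [measureReal_def, Measure.dirac_apply' _ (measurableSet_dTV_le p ε)]
      by_cases hs : dTV p (f s) ≤ ε
      · have hs' : s ∈ {s | ε < dTV p (f s)}ᶜ := not_lt.2 hs
        rw [Set.indicator_of_mem (by exact hs), Set.indicator_of_mem hs']
        simp [prodWeight]
      · have hs' : s ∉ {s | ε < dTV p (f s)}ᶜ := fun h => hs (not_lt.1 h)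
        rw [Set.indicator_of_notMem (by exact hs), Set.indicator_of_notMem hs']
        simp
    exact Finset.sum_congr rfl fun s _ => h2 s
  rw [h1, mass_compl (iid_mem_stdSimplex p N)]
  linarith

/-- Derandomization: on each sample, output the centre of a ball of radius `ε` that carries more
than half of the law of the randomized hypothesis. Two such balls intersect, so that this doubles
only the error and the failure probability. -/
lemma Procedure.exists_deterministic (P : Procedure n) (hn : 1 ≤ n) (ε : ℝ) :
    ∃ f : (Fin P.samples → Fin n) → Dist n, ∀ (p : Dist n) (δ : ℝ),
      1 - δ ≤ P.successProb p ε → mass (iid p P.samples) {s | 2 * ε < dTV p (f s)} ≤ 2 * δ := by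
  classical
  obtain ⟨h₀⟩ := dist_nonempty hn
  let ball : Dist n → Set (Dist n) := fun p => {h | dTV p h ≤ ε}
  let v : (Fin P.samples → Fin n) → Dist n → ℝ :=
    fun s p => (P.output s : Measure (Dist n)).real (ball p)
  refine ⟨fun s => if h : ∃ q, 1 / 2 < v s q then h.choose else h₀, fun p δ hp => ?_⟩
  have hw := iid_mem_stdSimplex p P.samples
  -- Markov's inequality: where the output is wrong, half of the law misses the ball at `p`.
  refine (mass_le_sum_mul hw.1 (F := fun s => 2 * (1 - v s p)) (fun s => ?_)
    fun s hs => ?_).trans ?_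
  · have : v s p ≤ 1 := measureReal_le_one
    linarith
  · by_contra! hlt
    have hv : 1 / 2 < v s p := by linarith
    have hex : ∃ q, 1 / 2 < v s q := ⟨p, hv⟩
    simp only [Set.mem_ofPred_eq, dif_pos hex] at hs
    have hq := hex.choose_spec
    set q := hex.choose
    have hinter : (ball p ∩ ball q).Nonempty := by
      by_contra hempty
      have hdisj := Set.disjoint_iff_inter_eq_empty.2 (Set.not_nonempty_iff_eq_empty.1 hempty)
      have h1 := measureReal_union (μ := (P.output s : Measure (Dist n))) hdisj
        (measurableSet_dTV_le q ε)
      have h2 : (P.output s : Measure (Dist n)).real (ball p ∪ ball q) ≤ 1 := measureReal_le_one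
      have h3 : v s p + v s q ≤ 1 := h1 ▸ h2
      linarith
    obtain ⟨r, hr1, hr2⟩ := hinter
    have h4 : dTV p r ≤ ε := hr1
    have h5 : dTV q r ≤ ε := hr2
    linarith [dTV_triangle p r q, dTV_comm q r]
  · have h6 : ∑ s, iid p P.samples s * (2 * (1 - v s p)) = 2 * (1 - P.successProb p ε) := by
      have h7 : P.successProb p ε = ∑ s, iid p P.samples s * v s p := rfl
      have h8 : ∀ s, iid p P.samples s * (2 * (1 - v s p)) =
          2 * iid p P.samples s - 2 * (iid p P.samples s * v s p) := fun s => by ring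
      rw [Finset.sum_congr rfl fun s _ => h8 s, Finset.sum_sub_distrib, ← Finset.mul_sum,
        ← Finset.mul_sum, hw.2, h7]
      ring
    rw [h6]
    linarith

end Deterministic

/-! ### Selecting a hypothesis from a finite family -/

section Selection

variable {n : ℕ} {I : Type*} [Fintype I]

/-- Minimum-distance selection over the Yatracos class of a finite family `g`: any hypothesis whose
probabilities of all Scheffé sets are within `ρ + τ` of the empirical ones is good enough. -/
lemma exists_selection [Nonempty I] (g : I → Dist n) (N : ℕ) {ρ τ : ℝ} (hτ : 0 ≤ τ)
    (hτ' : τ ≤ 2) :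
    ∃ sel : (Fin N → Fin n) → I, ∀ p : Dist n, (∃ i, dTV p (g i) ≤ ρ) →
      mass (iid p N) {y | 3 * ρ + 2 * τ < dTV p (g (sel y))} ≤
        2 * (Fintype.card I : ℝ) ^ 2 * Real.exp (-(N * τ ^ 2 / 4)) := by
  classical
  let ok : (Fin N → Fin n) → I → Prop := fun y i =>
    ∀ a b, |freq y (scheffe (g a) (g b)) - mass (g i).1 (scheffe (g a) (g b))| ≤ ρ + τ
  refine ⟨fun y => if h : ∃ i, ok y i then h.choose else Classical.arbitrary I, ?_⟩
  rintro p ⟨i₀, hi₀⟩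
  have hw := iid_mem_stdSimplex p N
  let dev : I × I → Set (Fin N → Fin n) := fun c =>
    {y | τ < |freq y (scheffe (g c.1) (g c.2)) - mass p.1 (scheffe (g c.1) (g c.2))|}
  have hsub : {y | 3 * ρ + 2 * τ < dTV p (g (if h : ∃ i, ok y i then h.choose
      else Classical.arbitrary I))} ⊆ ⋃ c, dev c := by
    intro y hy
    by_contra hnot
    simp only [dev, Set.mem_iUnion, Set.mem_ofPred_eq, not_exists, not_lt, Prod.forall] at hnot
    have hi₀ok : ok y i₀ := fun a b => by
      have := abs_sub_le (freq y (scheffe (g a) (g b))) (mass p.1 (scheffe (g a) (g b)))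
        (mass (g i₀).1 (scheffe (g a) (g b)))
      linarith [hnot a b, abs_mass_sub_mass_le_dTV p (g i₀) (scheffe (g a) (g b))]
    have hex : ∃ i, ok y i := ⟨i₀, hi₀ok⟩
    simp only [Set.mem_ofPred_eq, dif_pos hex] at hy
    have hok := hex.choose_spec
    set i := hex.choose
    -- Both `g i` and `g i₀` match the empirical frequency of their Scheffé set up to `ρ + τ`.
    have h1 := abs_le.1 (hok i i₀)
    have h2 := abs_le.1 (hi₀ok i i₀)
    have h3 := dTV_eq_mass_scheffe (g i) (g i₀)
    linarith [dTV_triangle p (g i₀) (g i), dTV_comm (g i) (g i₀)]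
  refine (mass_mono hw.1 hsub).trans ((mass_iUnion_le hw.1 dev).trans ?_)
  refine (Finset.sum_le_sum fun c _ => mass_freq_deviation_le p.2
    (scheffe (g c.1) (g c.2)) N hτ hτ').trans_eq ?_
  rw [Finset.sum_const, Finset.card_univ, Fintype.card_prod, nsmul_eq_mul]
  push_cast
  ring

end Selection

/-! ### Candidate mixtures -/

section Candidates

variable {n k s M : ℕ}

/-- The hypothesis for the `j`-th component under the labelling `L` of the samples `x`: apply the
learner `f` to `s` of the samples labelled `j`, provided that there are as many. -/
noncomputable def component (f : (Fin s → Fin n) → Dist n) (h₀ : Dist n) (L : Fin M → Fin k)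
    (x : Fin M → Fin n) (j : Fin k) : Dist n :=
  open scoped Classical in
  if h : Nonempty (Fin s ↪ {i // L i = j}) then f fun a => x (h.some a) else h₀

/-- The mixture of `h` with the weights `w j / T`, the remaining weight being given to `h₀`. -/
noncomputable def gridMixture (T : ℕ) (h₀ : Dist n) (h : Fin k → Dist n)
    (w : Fin k → Fin (T + 1)) : Dist n :=
  if hw : ∑ j, (w j : ℕ) ≤ T then
    ⟨fun i => ∑ j, ((w j : ℕ) : ℝ) / T * (h j).1 i + (1 - ∑ j, ((w j : ℕ) : ℝ) / T) * h₀.1 i, by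
      have h1 : ∑ j, ((w j : ℕ) : ℝ) / T ≤ 1 := by
        rw [← Finset.sum_div]
        exact div_le_one_of_le₀ (by exact_mod_cast hw) (Nat.cast_nonneg T)
      refine ⟨fun i => add_nonneg (Finset.sum_nonneg fun j _ =>
        mul_nonneg (by positivity) ((h j).2.1 i)) (mul_nonneg (by linarith) (h₀.2.1 i)), ?_⟩
      rw [Finset.sum_add_distrib, Finset.sum_comm, ← Finset.mul_sum, h₀.2.2]
      simp only [← Finset.mul_sum, (h _).2.2]
      simp⟩
  else h₀

/-- Rounding the mixing weights down to multiples of `1 / T` discards the components of weight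
below `1 / T`, and costs at most `k / T`. -/
lemma exists_dTV_gridMixture_le {T : ℕ} (hT : 0 < T) {μ : Fin k → ℝ}
    (hμ : μ ∈ stdSimplex ℝ (Fin k)) {q : Fin k → Dist n} {p : Dist n}
    (hp : ∀ i, p.1 i = ∑ j, μ j * (q j).1 i) (h₀ : Dist n) {ρ : ℝ} (hρ : 0 ≤ ρ) :
    ∃ w : Fin k → Fin (T + 1), ∀ h : Fin k → Dist n,
      (∀ j, 1 / (T : ℝ) ≤ μ j → dTV (q j) (h j) ≤ ρ) →
        dTV p (gridMixture T h₀ h w) ≤ ρ + k / T := by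
  have hT' : (0 : ℝ) < T := by exact_mod_cast hT
  have hle : ∀ j, (⌊T * μ j⌋₊ : ℝ) ≤ T * μ j := fun j =>
    Nat.floor_le (mul_nonneg hT'.le (hμ.1 j))
  have hsumR : ∑ j, (⌊T * μ j⌋₊ : ℝ) ≤ T := by
    refine (Finset.sum_le_sum fun j _ => hle j).trans_eq ?_
    rw [← Finset.mul_sum, hμ.2, mul_one]
  have hsum : ∑ j, ⌊T * μ j⌋₊ ≤ T := by exact_mod_cast hsumR
  have hlt : ∀ j, ⌊T * μ j⌋₊ < T + 1 := fun j => Nat.lt_succ_of_le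
    ((Finset.single_le_sum (f := fun j => ⌊T * μ j⌋₊) (fun _ _ => Nat.zero_le _)
      (Finset.mem_univ j)).trans hsum)
  refine ⟨fun j => ⟨⌊T * μ j⌋₊, hlt j⟩, fun h hh => ?_⟩
  have hu : ∃ u : Fin k → ℝ, ∀ j, u j = (⌊T * μ j⌋₊ : ℝ) / T := ⟨_, fun _ => rfl⟩
  obtain ⟨u, hu⟩ := hu
  have hu0 : ∀ j, 0 ≤ u j := fun j => by rw [hu]; positivity
  have huμ : ∀ j, u j ≤ μ j := fun j => by
    rw [hu, div_le_iff₀ hT']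
    exact (hle j).trans_eq (mul_comm _ _)
  have hu1 : ∑ j, u j ≤ 1 := (Finset.sum_le_sum fun j _ => huμ j).trans_eq hμ.2
  have hr : 1 - ∑ j, u j ≤ k / T := by
    rw [← hμ.2, ← Finset.sum_sub_distrib]
    have : ∀ j ∈ Finset.univ, μ j - u j ≤ 1 / (T : ℝ) := fun j _ => by
      rw [hu, sub_le_iff_le_add, ← add_div, le_div_iff₀ hT']
      linarith [Nat.lt_floor_add_one (T * μ j)]
    refine (Finset.sum_le_sum this).trans_eq ?_
    simp [div_eq_mul_inv]
  have hval : ∀ i, (gridMixture T h₀ h fun j => ⟨⌊T * μ j⌋₊, hlt j⟩).1 i =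
      ∑ j, u j * (h j).1 i + (1 - ∑ j, u j) * h₀.1 i := by
    intro i
    rw [gridMixture, dif_pos (by exact hsum)]
    simp only [hu]
  have hpt : ∀ i, |p.1 i - (gridMixture T h₀ h fun j => ⟨⌊T * μ j⌋₊, hlt j⟩).1 i| ≤
      ∑ j, u j * |(q j).1 i - (h j).1 i| + ∑ j, (μ j - u j) * (q j).1 i +
        (1 - ∑ j, u j) * h₀.1 i := by
    intro i
    have h1 : p.1 i - (gridMixture T h₀ h fun j => ⟨⌊T * μ j⌋₊, hlt j⟩).1 i =
        ∑ j, u j * ((q j).1 i - (h j).1 i) + ∑ j, (μ j - u j) * (q j).1 i -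
          (1 - ∑ j, u j) * h₀.1 i := by
      rw [hval, hp, ← Finset.sum_add_distrib]
      have : ∀ j, u j * ((q j).1 i - (h j).1 i) + (μ j - u j) * (q j).1 i =
          μ j * (q j).1 i - u j * (h j).1 i := fun j => by ring
      rw [Finset.sum_congr rfl fun j _ => this j, Finset.sum_sub_distrib]
      ring
    have h2 : |∑ j, u j * ((q j).1 i - (h j).1 i)| ≤ ∑ j, u j * |(q j).1 i - (h j).1 i| := by
      refine (Finset.abs_sum_le_sum_abs _ _).trans_eq (Finset.sum_congr rfl fun j _ => ?_)
      rw [abs_mul, abs_of_nonneg (hu0 j)]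
    have h3 : 0 ≤ ∑ j, (μ j - u j) * (q j).1 i := Finset.sum_nonneg fun j _ =>
      mul_nonneg (sub_nonneg.2 (huμ j)) ((q j).2.1 i)
    have h4 : 0 ≤ (1 - ∑ j, u j) * h₀.1 i := mul_nonneg (sub_nonneg.2 hu1) (h₀.2.1 i)
    rw [h1, abs_le]
    have h5 := abs_le.1 h2
    constructor <;> linarith [h5.1, h5.2]
  have hmain : dTV p (gridMixture T h₀ h fun j => ⟨⌊T * μ j⌋₊, hlt j⟩) ≤
      ∑ j, u j * dTV (q j) (h j) + (1 - ∑ j, u j) := by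
    refine (mul_le_mul_of_nonneg_left (Finset.sum_le_sum fun i _ => hpt i)
      (by norm_num : (0 : ℝ) ≤ 1 / 2)).trans_eq ?_
    rw [Finset.sum_add_distrib, Finset.sum_add_distrib, Finset.sum_comm, ← Finset.mul_sum,
      Finset.sum_comm (f := fun i j => (μ j - u j) * (q j).1 i), h₀.2.2]
    simp only [← Finset.mul_sum, (q _).2.2, mul_one, Finset.sum_sub_distrib, hμ.2, dTV]
    simp only [mul_left_comm (u _) (1 / 2 : ℝ), ← Finset.mul_sum]
    ring
  have hcomp : ∑ j, u j * dTV (q j) (h j) ≤ ρ := by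
    calc ∑ j, u j * dTV (q j) (h j) ≤ ∑ j, u j * ρ := by
          refine Finset.sum_le_sum fun j _ => ?_
          rcases Nat.eq_zero_or_pos ⌊T * μ j⌋₊ with h0 | h0
          · simp [hu, h0]
          · refine mul_le_mul_of_nonneg_left (hh j ?_) (hu0 j)
            rw [div_le_iff₀ hT', mul_comm]
            exact Nat.floor_pos.1 h0
      _ ≤ ρ := by
          rw [← Finset.sum_mul]
          exact mul_le_of_le_one_left hρ hu1
  linarith

/-- Sampling from a mixture amounts to drawing independent labels and then sampling from the
labelled components. -/
lemma iid_mixture {μ : Fin k → ℝ} {q : Fin k → Dist n} {p : Dist n}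
    (hp : ∀ i, p.1 i = ∑ j, μ j * (q j).1 i) (x : Fin M → Fin n) :
    iid p M x = ∑ L : Fin M → Fin k,
      prodWeight (fun _ => μ) L * prodWeight (fun i => (q (L i)).1) x := by
  have := sum_prodWeight_mul_prod (fun _ : Fin M => μ) fun i j => (q j).1 (x i)
  simp only [iid, prodWeight, hp] at this ⊢
  exact this.symm

/-- Under the true labelling, each component of weight at least `1 / T` is learned from its own
samples, except with small probability. -/
lemma mass_no_candidate_le {T : ℕ} (hT : 0 < T) {μ : Fin k → ℝ}
    (hμ : μ ∈ stdSimplex ℝ (Fin k)) {q : Fin k → Dist n} {p : Dist n}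
    (hp : ∀ i, p.1 i = ∑ j, μ j * (q j).1 i) (f : (Fin s → Fin n) → Dist n) (h₀ : Dist n)
    {ρ η : ℝ} (hρ : 0 ≤ ρ) (hη : 0 ≤ η)
    (hf : ∀ j, mass (iid (q j) s) {y | ρ < dTV (q j) (f y)} ≤ η) :
    mass (iid p M) {x | ∀ (L : Fin M → Fin k) (w : Fin k → Fin (T + 1)),
      ρ + k / T < dTV p (gridMixture T h₀ (component f h₀ L x) w)} ≤
      k * (Real.exp (s - M / (2 * T)) + η) := by
  classical
  obtain ⟨w, hw⟩ := exists_dTV_gridMixture_le hT hμ hp h₀ hρ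
  have hlab := prodWeight_mem_stdSimplex fun _ : Fin M => hμ
  have hcond : ∀ L : Fin M → Fin k, prodWeight (fun i => (q (L i)).1) ∈ stdSimplex ℝ _ :=
    fun L => prodWeight_mem_stdSimplex fun i => (q (L i)).2
  let bad : (Fin M → Fin k) → Fin k → Set (Fin M → Fin n) := fun L j =>
    {x | 1 / (T : ℝ) ≤ μ j ∧ ρ < dTV (q j) (component f h₀ L x j)}
  let E : Set (Fin M → Fin n) :=
    {x | ∀ (L : Fin M → Fin k) (w : Fin k → Fin (T + 1)),
      ρ + k / T < dTV p (gridMixture T h₀ (component f h₀ L x) w)}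
  let short : Fin k → Set (Fin M → Fin k) := fun j => {L | Fintype.card {i // L i = j} < s}
  have hE : ∀ L, E ⊆ ⋃ j, bad L j := by
    intro L x hx
    by_contra hnot
    simp only [bad, Set.mem_iUnion, Set.mem_ofPred_eq, not_exists, not_and, not_lt] at hnot
    exact absurd (hw _ hnot) (not_le.2 (hx L w))
  have hbad : ∀ j L, mass (prodWeight fun i => (q (L i)).1) (bad L j) ≤ η +
      (short j).indicator (fun _ => if 1 / (T : ℝ) ≤ μ j then 1 else 0) L := by
    intro j L
    by_cases hj : 1 / (T : ℝ) ≤ μ j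
    · by_cases hL : L ∈ short j
      · rw [Set.indicator_of_mem hL, if_pos hj]
        linarith [mass_le_one (hcond L) (bad L j)]
      · rw [Set.indicator_of_notMem hL, add_zero]
        have hne : Nonempty (Fin s ↪ {i // L i = j}) :=
          Function.Embedding.nonempty_of_card_le (by simpa [short] using hL)
        let e : Fin s ↪ Fin M := hne.some.trans (Function.Embedding.subtype _)
        have he : ∀ a, L (e a) = j := fun a => (hne.some a).2
        have hset : bad L j = {x | x ∘ e ∈ {y | ρ < dTV (q j) (f y)}} := by
          ext x
          simp only [bad, Set.mem_ofPred_eq, hj, true_and, component, dif_pos hne]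
          rfl
        rw [hset, mass_prodWeight_comp (fun i => (q (L i)).2.2) e]
        have : ((fun i => (q (L i)).1) ∘ e) = fun _ => (q j).1 := by
          funext a
          simp [he]
        rw [this]
        exact hf j
    · have : bad L j = ∅ := by
        ext x
        simp only [bad, Set.mem_ofPred_eq, hj, false_and, Set.mem_empty_iff_false]
      rw [this, if_neg hj, Set.indicator_zero, add_zero]
      simpa [mass] using hη
  have hshort : ∀ j, 1 / (T : ℝ) ≤ μ j →
      mass (prodWeight fun _ : Fin M => μ) (short j) ≤ Real.exp (s - M / (2 * T)) := by
    intro j hj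
    refine (mass_card_label_lt_le hμ j M s).trans (Real.exp_le_exp.2 ?_)
    have : (M : ℝ) / (2 * T) = 1 / T * M / 2 := by ring
    rw [this]
    have := mul_le_mul_of_nonneg_right hj (Nat.cast_nonneg (α := ℝ) M)
    linarith
  calc mass (iid p M) E
      = ∑ L, prodWeight (fun _ => μ) L * mass (prodWeight fun i => (q (L i)).1) E := by
        unfold mass
        simp only [Finset.mul_sum]
        rw [Finset.sum_comm]
        refine Finset.sum_congr rfl fun x _ => ?_
        by_cases hx : x ∈ E
        · simp only [Set.indicator_of_mem hx]
          exact iid_mixture hp x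
        · simp [Set.indicator_of_notMem hx]
    _ ≤ ∑ L, prodWeight (fun _ => μ) L * ∑ j, (η +
          (short j).indicator (fun _ => if 1 / (T : ℝ) ≤ μ j then 1 else 0) L) := by
        refine Finset.sum_le_sum fun L _ => mul_le_mul_of_nonneg_left ?_ (hlab.1 L)
        exact (mass_mono (hcond L).1 (hE L)).trans ((mass_iUnion_le (hcond L).1 _).trans
          (Finset.sum_le_sum fun j _ => hbad j L))
    _ = ∑ j, (η + (if 1 / (T : ℝ) ≤ μ j then 1 else 0) *
          mass (prodWeight fun _ : Fin M => μ) (short j)) := by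
        simp only [Finset.mul_sum]
        rw [Finset.sum_comm]
        refine Finset.sum_congr rfl fun j _ => ?_
        simp only [mul_add, Finset.sum_add_distrib, ← Finset.sum_mul, hlab.2, one_mul]
        rw [mass, Finset.mul_sum]
        congr 1
        refine Finset.sum_congr rfl fun L _ => ?_
        by_cases hL : L ∈ short j
        · simp only [Set.indicator_of_mem hL]
          ring
        · simp [Set.indicator_of_notMem hL]
    _ ≤ ∑ _j : Fin k, (Real.exp (s - M / (2 * T)) + η) := by
        refine Finset.sum_le_sum fun j _ => ?_
        split_ifs with hj
        · linarith [hshort j hj]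
        · linarith [Real.exp_pos (s - M / (2 * T) : ℝ)]
    _ = k * (Real.exp (s - M / (2 * T)) + η) := by
        rw [Finset.sum_const, Finset.card_univ, Fintype.card_fin, nsmul_eq_mul]

/-- Learning mixtures from a deterministic learner of the components: `M` samples produce the
candidates, `N` further samples select one of them. -/
lemma exists_mixture_learner {𝒞 : Set (Dist n)} (hn : 1 ≤ n) (hk : 1 ≤ k) {T : ℕ} (hT : 0 < T)
    (f : (Fin s → Fin n) → Dist n) (M N : ℕ) {ρ η τ : ℝ} (hρ : 0 ≤ ρ) (hη : 0 ≤ η)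
    (hf : ∀ q ∈ 𝒞, mass (iid q s) {y | ρ < dTV q (f y)} ≤ η) (hτ : 0 ≤ τ) (hτ' : τ ≤ 2) :
    ∃ F : (Fin (M + N) → Fin n) → Dist n, ∀ p ∈ mixtures k 𝒞,
      mass (iid p (M + N)) {z | 3 * (ρ + k / T) + 2 * τ < dTV p (F z)} ≤
        k * (Real.exp (s - M / (2 * T)) + η) +
          2 * ((k : ℝ) ^ M * ((T : ℝ) + 1) ^ k) ^ 2 * Real.exp (-(N * τ ^ 2 / 4)) := by
  classical
  obtain ⟨h₀⟩ := dist_nonempty hn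
  have : Nonempty (Fin k) := ⟨⟨0, hk⟩⟩
  let g : (Fin M → Fin n) → (Fin M → Fin k) × (Fin k → Fin (T + 1)) → Dist n := fun x c =>
    gridMixture T h₀ (component f h₀ c.1 x) c.2
  choose sel hsel using fun x => exists_selection (g x) N (ρ := ρ + k / T) hτ hτ'
  refine ⟨fun z => g (fun i => z (Fin.castAdd N i))
    (sel (fun i => z (Fin.castAdd N i)) fun i => z (Fin.natAdd M i)), ?_⟩
  rintro p ⟨μ, hμ, q, hq, hp⟩
  have hbad := mass_no_candidate_le (M := M) hT hμ hp f h₀ hρ hη fun j => hf (q j) (hq j)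
  refine (mass_append_le p.2 {x | ∀ (L : Fin M → Fin k) (w : Fin k → Fin (T + 1)), ρ + k / T <
      dTV p (gridMixture T h₀ (component f h₀ L x) w)}
    (fun x => {y | 3 * (ρ + k / T) + 2 * τ < dTV p (g x (sel x y))}) (by positivity)
    fun x hx => ?_).trans (add_le_add_left hbad _)
  simp only [Set.mem_ofPred_eq, not_forall, not_lt] at hx
  obtain ⟨L, w, hLw⟩ := hx
  have := hsel x p ⟨(L, w), hLw⟩
  simpa [Fintype.card_prod, Fintype.card_fun] using this

end Candidates

/-! ### Sample size -/

/-- With these choices of `T`, `M` and `N`, both terms of the sample size are dominated by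
`k / ε ^ 3` up to logarithms: `M` is of order `T * m * log (k / δ)` with `T` of order `k / ε`, and
`N` is of order `(M * log k + k * log T + log (1 / δ)) / ε ^ 2`. The lower bound `m₀` on `m`
absorbs the terms without a factor `m`, and the bound `δ ≤ δ₀ < 1` those without a factor
`log (1 / δ)`. -/
lemma sample_size_le {δ₀ m₀ : ℝ} (hδ₀ : 0 < δ₀) (hδ₀' : δ₀ < 1) (hm₀ : 0 < m₀) :
    ∃ K : ℝ, 0 < K ∧ ∀ (k s T M N : ℕ) (ε δ m : ℝ), 1 ≤ k → 0 < ε → ε < 1 → 0 < δ → δ ≤ δ₀ →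
      m₀ ≤ m → (s : ℝ) ≤ m * Real.log (6 * k / δ) → T = ⌈20 * k / ε⌉₊ →
      M = ⌈2 * T * (s + Real.log (6 * k / δ))⌉₊ →
      N = ⌈64 / ε ^ 2 *
        (Real.log (6 / δ) + 2 * (M * Real.log k + k * Real.log ((T : ℝ) + 1)))⌉₊ →
      ((M + N : ℕ) : ℝ) ≤ (K * ((k : ℝ) / ε ^ 3) * Real.log (2 + (k : ℝ) / ε) ^ 2) *
        m * Real.log (1 / δ) ^ 2 := by
  obtain ⟨l, hl⟩ : ∃ l, l = Real.log (1 / δ₀) := ⟨_, rfl⟩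
  have hl0 : 0 < l := by
    rw [hl]
    exact Real.log_pos (by rw [lt_div_iff₀ hδ₀]; linarith)
  obtain ⟨a, ha⟩ : ∃ a, a = 3 / l + 1 := ⟨_, rfl⟩
  obtain ⟨b, hb⟩ : ∃ b, b = 1 / m₀ := ⟨_, rfl⟩
  obtain ⟨B, hB⟩ : ∃ B, B = 43 * (1 + b) * a := ⟨_, rfl⟩
  have ha0 : 0 < a := by rw [ha]; positivity
  have hb0 : 0 < b := by rw [hb]; positivity
  have hB0 : 0 < B := by rw [hB]; positivity
  refine ⟨(B + 64 * (a * b + 2 * B + 8 * b / l) + b / l) / l, by positivity, ?_⟩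
  intro k s T M N ε δ m hk hε hε1 hδ hδδ₀ hm hs hT hM hN
  have hk' : (1 : ℝ) ≤ k := by exact_mod_cast hk
  obtain ⟨κ, hκ⟩ : ∃ κ, κ = (k : ℝ) / ε := ⟨_, rfl⟩
  obtain ⟨Λ, hΛ⟩ : ∃ Λ, Λ = Real.log (2 + κ) := ⟨_, rfl⟩
  obtain ⟨lam, hlam⟩ : ∃ lam, lam = Real.log (1 / δ) := ⟨_, rfl⟩
  obtain ⟨ℓ, hℓ⟩ : ∃ ℓ, ℓ = Real.log (6 * k / δ) := ⟨_, rfl⟩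
  have hkκ : (k : ℝ) ≤ κ := by
    rw [hκ]
    exact le_div_self (by positivity) hε hε1.le
  have hκ1 : 1 ≤ κ := hk'.trans hkκ
  have hκ2 : 0 ≤ κ ^ 2 := by positivity
  have hκ3 : 0 ≤ κ ^ 3 := by positivity
  have hκ4 : 0 ≤ κ ^ 4 := by positivity
  have hexp : Real.exp 1 ≤ 3 := by linarith [Real.exp_one_lt_d9]
  have hΛ1 : 1 ≤ Λ := by
    rw [hΛ, Real.le_log_iff_exp_le (by linarith)]
    linarith
  have hlaml : l ≤ lam := by
    rw [hl, hlam]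
    exact Real.log_le_log (by positivity) (one_div_le_one_div_of_le hδ hδδ₀)
  have hlam0 : 0 < lam := hl0.trans_le hlaml
  have hlam1 : 1 ≤ lam / l := (one_le_div hl0).2 hlaml
  have hbm : 1 ≤ b * m := by
    rw [hb, one_div, inv_mul_eq_div]
    exact (one_le_div hm₀).2 hm
  have hm0 : 0 < m := hm₀.trans_le hm
  have hδ1 : δ < 1 := hδδ₀.trans_lt hδ₀'
  -- Logarithms of polynomials in `κ` are multiples of `Λ`.
  have hlog6 : Real.log (6 * k) ≤ 3 * Λ := by
    rw [hΛ, ← Real.log_rpow (by linarith)]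
    refine Real.log_le_log (by linarith) ?_
    norm_cast
    push_cast
    have h1 : (2 + κ) ^ 3 = 8 + 12 * κ + 6 * κ ^ 2 + κ ^ 3 := by ring
    rw [h1]
    linarith only [hkκ, hκ1, hκ2, hκ3]
  have hℓeq : ℓ = Real.log (6 * k) + lam := by
    rw [hℓ, hlam, ← Real.log_mul (by positivity) (by positivity)]
    ring_nf
  have hℓle : ℓ ≤ a * Λ * lam := by
    have h1 : 3 * Λ ≤ 3 / l * Λ * lam := by
      have : 3 / l * Λ * lam = 3 * Λ * (lam / l) := by ring
      rw [this]
      exact le_mul_of_one_le_right (by linarith) hlam1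
    have h2 : lam ≤ Λ * lam := le_mul_of_one_le_left hlam0.le hΛ1
    have h3 : (3 / l + 1) * Λ * lam = 3 / l * Λ * lam + Λ * lam := by ring
    rw [hℓeq, ha, h3]
    linarith only [hlog6, h1, h2]
  have hℓ1 : 1 ≤ ℓ := by
    have : 1 ≤ Real.log (6 * k) := by
      rw [Real.le_log_iff_exp_le (by positivity)]
      linarith only [hexp, hk']
    linarith only [hℓeq, this, hlam0]
  have hTle : (T : ℝ) ≤ 21 * κ := by
    rw [hT]
    have h1 := (Nat.ceil_lt_add_one (a := 20 * (k : ℝ) / ε) (by positivity)).le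
    have h2 : 20 * (k : ℝ) / ε = 20 * κ := by rw [hκ]; ring
    rw [h2] at h1 ⊢
    linarith only [h1, hκ1]
  have hlogk : Real.log k ≤ Λ := by
    rw [hΛ]
    exact Real.log_le_log (by linarith) (by linarith)
  have hlogT : Real.log ((T : ℝ) + 1) ≤ 4 * Λ := by
    rw [hΛ, ← Real.log_rpow (by linarith)]
    refine Real.log_le_log (by positivity) ?_
    norm_cast
    push_cast
    have h1 : (2 + κ) ^ 4 = 16 + 32 * κ + 24 * κ ^ 2 + 8 * κ ^ 3 + κ ^ 4 := by ring
    rw [h1]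
    linarith only [hTle, hκ1, hκ2, hκ3, hκ4]
  have hlog6δ : Real.log (6 / δ) ≤ ℓ := by
    rw [hℓ]
    refine Real.log_le_log (by positivity) ?_
    gcongr
    linarith
  have hMle : (M : ℝ) ≤ B * (κ * m * Λ * lam) := by
    have h1 : (M : ℝ) ≤ 2 * T * (s + ℓ) + 1 := by
      rw [hM, ← hℓ]
      exact (Nat.ceil_lt_add_one (by positivity)).le
    have h2 : (s : ℝ) + ℓ ≤ (1 + b) * m * ℓ := by
      have := le_mul_of_one_le_left (zero_le_one.trans hℓ1) hbm
      rw [← hℓ] at hs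
      have e : (1 + b) * m * ℓ = m * ℓ + b * m * ℓ := by ring
      rw [e]
      linarith only [hs, this]
    have h3 : 2 * T * (s + ℓ) ≤ 2 * (21 * κ) * ((1 + b) * m * ℓ) := by gcongr
    have h4 : 1 ≤ (1 + b) * (κ * m * ℓ) := by
      have h5 : 1 ≤ κ * ℓ := one_le_mul_of_one_le_of_one_le hκ1 hℓ1
      have h6 : 1 ≤ (1 + b) * m := by linarith only [hbm, hm0]
      have := one_le_mul_of_one_le_of_one_le h5 h6
      calc (1 : ℝ) ≤ κ * ℓ * ((1 + b) * m) := this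
        _ = (1 + b) * (κ * m * ℓ) := by ring
    have h7 : (M : ℝ) ≤ 43 * (1 + b) * (κ * m * ℓ) := by
      have e1 : 2 * (21 * κ) * ((1 + b) * m * ℓ) = 42 * ((1 + b) * (κ * m * ℓ)) := by ring
      have e2 : 43 * (1 + b) * (κ * m * ℓ) = 43 * ((1 + b) * (κ * m * ℓ)) := by ring
      rw [e1] at h3
      rw [e2]
      linarith only [h1, h3, h4]
    refine h7.trans ?_
    have : B * (κ * m * Λ * lam) = 43 * (1 + b) * (κ * m * (a * Λ * lam)) := by rw [hB]; ring
    rw [this]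
    gcongr
  obtain ⟨X, hX⟩ : ∃ X, X = κ * m * Λ ^ 2 * lam := ⟨_, rfl⟩
  have hMX : (M : ℝ) ≤ B * X := by
    refine hMle.trans ?_
    rw [hX]
    gcongr
    exact le_self_pow₀ hΛ1 two_ne_zero
  have hX1 : 1 ≤ b / l * X := by
    have : b / l * X = κ * (b * m) * Λ ^ 2 * (lam / l) := by rw [hX]; ring
    rw [this]
    exact one_le_mul_of_one_le_of_one_le (one_le_mul_of_one_le_of_one_le
      (one_le_mul_of_one_le_of_one_le hκ1 hbm) (one_le_pow₀ hΛ1)) hlam1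
  have hX0 : 0 < X := by rw [hX]; positivity
  have hterm1 : Real.log (6 / δ) ≤ a * b * X := by
    have h1 : a * b * X = a * Λ * lam * (κ * (b * m) * Λ) := by rw [hX]; ring
    rw [h1]
    exact (hlog6δ.trans hℓle).trans (le_mul_of_one_le_right (by positivity)
      (one_le_mul_of_one_le_of_one_le (one_le_mul_of_one_le_of_one_le hκ1 hbm) hΛ1))
  have hterm2 : M * Real.log k ≤ B * X := by
    have h1 : B * X = B * (κ * m * Λ * lam) * Λ := by rw [hX]; ring
    rw [h1]
    exact mul_le_mul hMle hlogk (Real.log_nonneg hk') (by positivity)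
  have hterm3 : k * Real.log ((T : ℝ) + 1) ≤ 4 * b / l * X := by
    have h1 : 4 * b / l * X = κ * (4 * Λ) * ((b * m) * Λ * (lam / l)) := by rw [hX]; ring
    rw [h1]
    exact (mul_le_mul hkκ hlogT (Real.log_nonneg (by linarith [Nat.cast_nonneg (α := ℝ) T]))
      (by positivity)).trans (le_mul_of_one_le_right (by positivity)
        (one_le_mul_of_one_le_of_one_le (one_le_mul_of_one_le_of_one_le hbm hΛ1) hlam1))
  have hNle : (N : ℝ) ≤ 64 / ε ^ 2 * ((a * b + 2 * B + 8 * b / l) * X) + 1 := by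
    have hnn : 0 ≤ 64 / ε ^ 2 *
        (Real.log (6 / δ) + 2 * (M * Real.log k + k * Real.log ((T : ℝ) + 1))) := by
      have h1 : 0 ≤ Real.log (6 / δ) :=
        Real.log_nonneg (by rw [le_div_iff₀ hδ]; linarith)
      have h2 := Real.log_nonneg hk'
      have h3 : 0 ≤ Real.log ((T : ℝ) + 1) :=
        Real.log_nonneg (by linarith [Nat.cast_nonneg (α := ℝ) T])
      positivity
    rw [hN]
    refine (Nat.ceil_lt_add_one hnn).le.trans ?_
    gcongr
    have : (a * b + 2 * B + 8 * b / l) * X =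
        a * b * X + 2 * (B * X) + 2 * (4 * b / l * X) := by ring
    rw [this]
    linarith only [hterm1, hterm2, hterm3]
  have hinv : 1 ≤ 1 / ε ^ 2 := by
    rw [le_div_iff₀ (by positivity), one_mul]
    exact pow_le_one₀ hε.le hε1.le
  have htotal : ((M + N : ℕ) : ℝ) ≤
      1 / ε ^ 2 * ((B + 64 * (a * b + 2 * B + 8 * b / l) + b / l) * X) := by
    push_cast
    have h1 : B * X ≤ 1 / ε ^ 2 * (B * X) := le_mul_of_one_le_left (by positivity) hinv
    have h2 : b / l * X ≤ 1 / ε ^ 2 * (b / l * X) := le_mul_of_one_le_left (by positivity) hinv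
    have h3 : 64 / ε ^ 2 * ((a * b + 2 * B + 8 * b / l) * X) =
      1 / ε ^ 2 * (64 * (a * b + 2 * B + 8 * b / l) * X) := by ring
    rw [h3] at hNle
    have h4 : 1 / ε ^ 2 * ((B + 64 * (a * b + 2 * B + 8 * b / l) + b / l) * X) =
        1 / ε ^ 2 * (B * X) + 1 / ε ^ 2 * (64 * (a * b + 2 * B + 8 * b / l) * X) +
          1 / ε ^ 2 * (b / l * X) := by ring
    rw [h4]
    linarith only [hMX, hNle, hX1, h1, h2]
  refine htotal.trans ?_
  rw [← hκ, ← hΛ, ← hlam]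
  have hfin : (B + 64 * (a * b + 2 * B + 8 * b / l) + b / l) / l * ((k : ℝ) / ε ^ 3) * Λ ^ 2 *
      m * lam ^ 2 =
      1 / ε ^ 2 * ((B + 64 * (a * b + 2 * B + 8 * b / l) + b / l) * X) * (lam / l) := by
    rw [hX, hκ]
    field_simp
  rw [hfin]
  exact le_mul_of_one_le_right (by positivity) hlam1

end MixtureLearning

open MixtureLearning in
theorem mainTheorem11 (δ₀ : ℝ) (hδ₀ : 0 < δ₀) (hδ₀' : δ₀ < 1) :
    ∃ (K : ℝ) (c : ℕ), 0 < K ∧ ∀ (n k : ℕ), 1 ≤ n → 1 ≤ k →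
      ∀ (𝒞 : Set (MixtureLearning.Dist n)) (m : ℕ → ℝ → ℝ) (A : MixtureLearning.Algorithm n),
        A.Learns 𝒞 δ₀ (fun ε δ => m n ε * Real.log (1 / δ)) →
        ∃ A' : MixtureLearning.Algorithm n,
          A'.Learns (MixtureLearning.mixtures k 𝒞) δ₀ (fun ε δ =>
            (K * ((k : ℝ) / ε ^ 3) * Real.log (2 + (k : ℝ) / ε) ^ c) *
              m n (ε / 20) * Real.log (1 / δ) ^ 2) := by
  -- A confidence parameter below `1 / 2`, so that a learner without samples is still constrained.
  obtain ⟨δ₁, hδ₁⟩ : ∃ δ₁, δ₁ = min δ₀ (1 / 4) := ⟨_, rfl⟩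
  have hδ₁0 : 0 < δ₁ := by rw [hδ₁]; positivity
  have hδ₁δ₀ : δ₁ ≤ δ₀ := hδ₁ ▸ min_le_left _ _
  have hδ₁4 : δ₁ ≤ 1 / 4 := hδ₁ ▸ min_le_right _ _
  have hlog₁ : 0 < Real.log (1 / δ₁) := Real.log_pos (by rw [lt_div_iff₀ hδ₁0]; linarith)
  obtain ⟨K, hK, hsize⟩ := sample_size_le hδ₀ hδ₀' (one_div_pos.2 hlog₁)
  refine ⟨K, 2, hK, fun n k hn hk 𝒞 m A hA => ?_⟩
  have hk' : (1 : ℝ) ≤ k := by exact_mod_cast hk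
  suffices h : ∀ ε δ : ℝ, ∃ P : Procedure n, 0 < ε → ε < 1 → 0 < δ → δ ≤ δ₀ →
      (P.samples : ℝ) ≤ (K * ((k : ℝ) / ε ^ 3) * Real.log (2 + (k : ℝ) / ε) ^ 2) *
        m n (ε / 20) * Real.log (1 / δ) ^ 2 ∧
      ∀ p ∈ mixtures k 𝒞, 1 - δ ≤ P.successProb p ε by
    choose A' hA' using h
    exact ⟨A', hA'⟩
  intro ε δ
  obtain ⟨h₀⟩ := dist_nonempty hn
  by_cases hrange : 0 < ε ∧ ε < 1 ∧ 0 < δ ∧ δ ≤ δ₀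
  swap
  · exact ⟨Procedure.ofFun (N := 0) fun _ => h₀, fun h1 h2 h3 h4 =>
      absurd ⟨h1, h2, h3, h4⟩ hrange⟩
  obtain ⟨hε, hε1, hδ, hδδ₀⟩ := hrange
  suffices h : ∃ P : Procedure n, (P.samples : ℝ) ≤ (K * ((k : ℝ) / ε ^ 3) *
      Real.log (2 + (k : ℝ) / ε) ^ 2) * m n (ε / 20) * Real.log (1 / δ) ^ 2 ∧
      ∀ p ∈ mixtures k 𝒞, 1 - δ ≤ P.successProb p ε from h.imp fun P hP _ _ _ _ => hP
  obtain ⟨hs₁, hlearn₁⟩ := hA (ε / 20) δ₁ (by positivity) (by linarith) hδ₁0 hδ₁δ₀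
  rcases Nat.eq_zero_or_pos (A (ε / 20) δ₁).samples with hzero | hpos
  · -- A learner without samples forces the whole class into a ball of radius `ε / 10`.
    obtain ⟨f, hf⟩ := (A (ε / 20) δ₁).exists_deterministic hn (ε / 20)
    have hsub : Subsingleton (Fin (A (ε / 20) δ₁).samples → Fin n) := by
      rw [hzero]
      infer_instance
    have hclose : ∀ q ∈ 𝒞, dTV q (f fun _ => ⟨0, hn⟩) ≤ ε := by
      intro q hq
      by_contra! hlt
      have h1 := hf q δ₁ (hlearn₁ q hq)
      have h2 : {y | 2 * (ε / 20) < dTV q (f y)} = Set.univ := by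
        refine Set.eq_univ_of_forall fun y => ?_
        rw [Set.mem_ofPred_eq, Subsingleton.elim y fun _ => ⟨0, hn⟩]
        linarith
      rw [h2, mass_univ (iid_mem_stdSimplex q _)] at h1
      linarith
    refine ⟨Procedure.ofFun (N := 0) fun _ => f fun _ => ⟨0, hn⟩, ?_, fun p hp => ?_⟩
    · have hm : 0 ≤ m n (ε / 20) :=
        nonneg_of_mul_nonneg_left ((Nat.cast_nonneg _).trans hs₁) hlog₁
      have : (((Procedure.ofFun (N := 0) fun _ => f fun _ => ⟨0, hn⟩).samples : ℕ) : ℝ) = 0 :=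
        Nat.cast_zero
      rw [this]
      have hΛ : 0 ≤ Real.log (2 + (k : ℝ) / ε) :=
        Real.log_nonneg (by linarith [div_nonneg (zero_le_one.trans hk') hε.le])
      positivity
    · refine le_successProb_ofFun _ p ?_
      obtain ⟨μ, hμ, q, hq, hpq⟩ := hp
      have := dTV_mixture_le hμ hpq fun j => hclose (q j) (hq j)
      simp [mass, this.not_gt, hδ.le]
  -- Otherwise `m n (ε / 20)` is bounded below by a constant.
  have hm : 1 / Real.log (1 / δ₁) ≤ m n (ε / 20) := by
    rw [div_le_iff₀ hlog₁]
    exact le_trans (by exact_mod_cast hpos) hs₁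
  -- The failure probability splits as `δ / 6` for the label counts, `δ / 3` for the `k` component
  -- learners and `δ / 3` for the selection; the error as `3 * (ε / 10 + ε / 20) + 2 * (ε / 4) < ε`.
  obtain ⟨hs, hlearn⟩ := hA (ε / 20) (δ / (6 * k)) (by positivity) (by linarith) (by positivity)
    ((div_le_self hδ.le (by linarith)).trans hδδ₀)
  have hs' : ((A (ε / 20) (δ / (6 * k))).samples : ℝ) ≤
      m n (ε / 20) * Real.log (6 * k / δ) := by
    simpa only [one_div_div] using hs
  obtain ⟨f, hf⟩ := (A (ε / 20) (δ / (6 * k))).exists_deterministic hn (ε / 20)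
  obtain ⟨s, hsdef⟩ : ∃ s, s = (A (ε / 20) (δ / (6 * k))).samples := ⟨_, rfl⟩
  obtain ⟨T, hT⟩ : ∃ T, T = ⌈20 * (k : ℝ) / ε⌉₊ := ⟨_, rfl⟩
  obtain ⟨M, hM⟩ : ∃ M, M = ⌈2 * T * (s + Real.log (6 * k / δ))⌉₊ := ⟨_, rfl⟩
  obtain ⟨N, hN⟩ : ∃ N, N = ⌈64 / ε ^ 2 *
    (Real.log (6 / δ) + 2 * (M * Real.log k + k * Real.log ((T : ℝ) + 1)))⌉₊ := ⟨_, rfl⟩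
  have hTge : 20 * (k : ℝ) / ε ≤ T := hT ▸ Nat.le_ceil _
  have hTpos : (0 : ℝ) < T := lt_of_lt_of_le (by positivity) hTge
  obtain ⟨F, hF⟩ := exists_mixture_learner (k := k) hn hk (T := T) (by exact_mod_cast hTpos) f M N
    (ρ := 2 * (ε / 20)) (η := 2 * (δ / (6 * k))) (τ := ε / 4) (by positivity) (by positivity)
    (fun q hq => hf q _ (hlearn q hq)) (by positivity) (by linarith)
  refine ⟨Procedure.ofFun F, hsize k s T M N ε δ _ hk hε hε1 hδ hδδ₀ hm (hsdef ▸ hs') hT hM hN,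
    fun p hp => le_successProb_ofFun F p ?_⟩
  refine (mass_mono (iid_mem_stdSimplex p _).1 fun z hz => ?_).trans ((hF p hp).trans ?_)
  · have hkT : (k : ℝ) / T ≤ ε / 20 := by
      rw [div_le_iff₀ hε] at hTge
      rw [div_le_iff₀ hTpos]
      linarith
    have hz' : ε < dTV p (F z) := hz
    change 3 * (2 * (ε / 20) + (k : ℝ) / T) + 2 * (ε / 4) < dTV p (F z)
    linarith
  · rw [← hsdef]
    have h1 : Real.exp (s - M / (2 * T)) ≤ δ / (6 * k) := by
      have h2 : 2 * T * (s + Real.log (6 * k / δ)) ≤ M := hM ▸ Nat.le_ceil _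
      have h3 : s + Real.log (6 * k / δ) ≤ M / (2 * T) := by
        rw [le_div_iff₀ (by positivity)]
        linarith
      have h4 : δ / (6 * k) = Real.exp (-Real.log (6 * k / δ)) := by
        rw [Real.exp_neg, Real.exp_log (by positivity), inv_div]
      rw [h4, Real.exp_le_exp]
      linarith
    have h5 : ((k : ℝ) ^ M * ((T : ℝ) + 1) ^ k) ^ 2 =
        Real.exp (2 * (M * Real.log k + k * Real.log ((T : ℝ) + 1))) := by
      rw [← Real.exp_log (show 0 < ((k : ℝ) ^ M * ((T : ℝ) + 1) ^ k) ^ 2 by positivity),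
        Real.log_pow, Real.log_mul (by positivity) (by positivity), Real.log_pow, Real.log_pow]
      push_cast
      rfl
    have h6 : Real.log (6 / δ) + 2 * (M * Real.log k + k * Real.log ((T : ℝ) + 1)) ≤
        N * (ε / 4) ^ 2 / 4 := by
      have h7 : 64 / ε ^ 2 * (Real.log (6 / δ) +
          2 * (M * Real.log k + k * Real.log ((T : ℝ) + 1))) ≤ N := hN ▸ Nat.le_ceil _
      rw [div_mul_eq_mul_div, div_le_iff₀ (by positivity)] at h7
      linarith
    have h8 : ((k : ℝ) ^ M * ((T : ℝ) + 1) ^ k) ^ 2 * Real.exp (-(N * (ε / 4) ^ 2 / 4)) ≤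
        δ / 6 := by
      have h9 : δ / 6 = Real.exp (-Real.log (6 / δ)) := by
        rw [Real.exp_neg, Real.exp_log (by positivity), inv_div]
      rw [h5, h9, ← Real.exp_add, Real.exp_le_exp]
      linarith
    have h10 : k * (Real.exp (s - M / (2 * T)) + 2 * (δ / (6 * k))) ≤ δ / 2 := by
      have h11 : k * (δ / (6 * k)) = δ / 6 := by field_simp
      have := mul_le_mul_of_nonneg_left h1 (zero_le_one.trans hk')
      linarith
    linarith
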